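/- Let $d\ge 0$ and $q\in(0,1)$ be fixed, and let $S\subset\mathbb{Z}^d\setminus\{0\}$ be a finite set that generates $\mathbb{Z}^d$ as a group. For every $n\in\mathbb{N}$ let $V_n=[-n,n]^d\cap\mathbb{Z}^d$, considered as the Abelian group $\mathbb{Z}_{2n+1}^d$, and put $N_n=|V_n|=(2n+1)^d$. Let $\mathcal{G}^{(n)}$ be the Cayley graph on $V_n$ generated by $S_n=S\cap[-n,n]^d$, that is, the directed graph with an edge from $g$ to $h$ if and only if $h-g\in S_n$ (the difference being taken in $\mathbb{Z}_{2n+1}^d$). The Broadcast Gossip Algorithm with parameter $q$ on $\mathcal{G}^{(n)}$, started at $x(0)\in\mathbb{R}^{V_n}$, is the following random process: at each time $t=0,1,2,\dots$ a node $v(t)$ is drawn uniformly from $V_n$, independently of all other draws; then $x_u(t+1)=(1-q)\,x_u(t)+q\,x_{v(t)}(t)$ for every $u$ such that $(v(t),u)$ is an edge, and $x_u(t+1)=x_u(t)$ for all other $u$. Let $x_{\mathrm{ave}}(t)=\frac1{N_n}\sum_{u\in V_n}x_u(t)$. Then for every $n$ there is a matrix $B_n\in\mathbb{R}^{V_n\times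 V_n}$ such that, for every initial state $x(0)\in\mathbb{R}^{V_n}$, $$\lim_{t\to\infty}\mathbb{E}\big[\,|x_{\mathrm{ave}}(t)-x_{\mathrm{ave}}(0)|^2\,\big]=x(0)^{*}B_n\,x(0),$$ the trace of $B_n$ is uniquely determined by this property, and the algorithm is asymptotically unbiased on the sequence $(\mathcal{G}^{(n)})$: $$\lim_{n\to\infty}\operatorname{tr}(B_n)=0.$$ -/

import Mathlib

open MeasureTheory ProbabilityTheory Filter
open scoped Topology

noncomputable section

/-- The Cayley graph generated by `S` in an additive group `G`: the node set is `G`, and there is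
an edge from `g` to `h` iff `h - g ∈ S`. -/
def cayleyDigraph {G : Type*} [AddGroup G] (S : Set G) : Digraph G where
  Adj g h := h - g ∈ S

/-- `latticeGenerators S n` is the set `S ∩ [-n, n]^d`, where the box `[-n, n]^d` is identified
with the group `(ℤ / (2n+1))^d` through the (injective on the box) reduction map. -/
def latticeGenerators {d : ℕ} (S : Finset (Fin d → ℤ)) (n : ℕ) :
    Set (Fin d → ZMod (2 * n + 1)) :=
  (fun s i => (s i : ZMod (2 * n + 1))) '' {s | s ∈ S ∧ ∀ i, |s i| ≤ (n : ℤ)}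

/-- The Cayley graph on `(ℤ / (2n+1))^d` generated by `S ∩ [-n, n]^d`. -/
def latticeCayleyDigraph {d : ℕ} (S : Finset (Fin d → ℤ)) (n : ℕ) :
    Digraph (Fin d → ZMod (2 * n + 1)) :=
  cayleyDigraph (latticeGenerators S n)

open Classical in
/-- One step of the Broadcast Gossip Algorithm in which node `v` broadcasts: each out-neighbor `u`
of `v` moves to a convex combination of its own value and the value of `v`; the other nodes keep
their values. -/
def bgaStep {V : Type*} (G : Digraph V) (q : ℝ) (v : V) (x : V → ℝ) : V → ℝ :=
  fun u => if G.Adj v u then (1 - q) * x u + q * x v else x u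

/-- The state of the Broadcast Gossip Algorithm at time `t` when the initial state is `x₀` and
`v s` is the node that broadcasts at time `s`. -/
def bgaState {V : Type*} (G : Digraph V) (q : ℝ) (v : ℕ → V) (x₀ : V → ℝ) : ℕ → V → ℝ
  | 0 => x₀
  | t + 1 => bgaStep G q (v t) (bgaState G q v x₀ t)

/-- The random sequence `v 0, v 1, …` of nodes is independent and each `v t` is uniformly
distributed over the finite set `V` (which carries the discrete σ-algebra). -/
structure IsUniformIID {Ω V : Type*} [MeasurableSpace Ω] [Fintype V] (μ : Measure Ω)
    (v : ℕ → Ω → V) : Prop where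
  measurable : ∀ t, Measurable[_, (⊤ : MeasurableSpace V)] (v t)
  indep : iIndepFun (m := fun _ => (⊤ : MeasurableSpace V)) v μ
  uniform : ∀ t u, μ {ω | v t ω = u} = (Fintype.card V : ENNReal)⁻¹

/-- The average of the values of a state. -/
def nodeAverage {V : Type*} [Fintype V] (x : V → ℝ) : ℝ :=
  (Fintype.card V : ℝ)⁻¹ * ∑ u, x u

/-- `B` is a bias matrix of the randomized algorithm whose state at time `t`, started at `x₀`, is
the random vector `x x₀ t`: for every initial state, the mean square deviation of the average from
the initial average converges to `x₀ᵀ B x₀` as time goes to infinity. -/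
def IsBiasMatrix {Ω V : Type*} [MeasurableSpace Ω] [Fintype V] (μ : Measure Ω)
    (x : (V → ℝ) → ℕ → Ω → V → ℝ) (B : Matrix V V ℝ) : Prop :=
  ∀ x₀ : V → ℝ,
    Tendsto (fun t => ∫ ω, |nodeAverage (x x₀ t ω) - nodeAverage x₀| ^ 2 ∂μ) atTop
      (𝓝 (x₀ ⬝ᵥ B.mulVec x₀))

/-- A sequence of randomized algorithms is asymptotically unbiased if each of them has a bias
matrix and the traces of the bias matrices tend to `0`. (A bias matrix is determined only up to
adding an antisymmetric matrix, so its trace is well defined.) -/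
def AsymptoticallyUnbiased {Ω V : ℕ → Type*} [∀ n, MeasurableSpace (Ω n)] [∀ n, Fintype (V n)]
    (μ : ∀ n, Measure (Ω n)) (x : ∀ n, (V n → ℝ) → ℕ → Ω n → V n → ℝ) : Prop :=
  (∀ n, ∃ B : Matrix (V n) (V n) ℝ, IsBiasMatrix (μ n) (x n) B) ∧
    ∀ B : ∀ n, Matrix (V n) (V n) ℝ, (∀ n, IsBiasMatrix (μ n) (x n) (B n)) →
      Tendsto (fun n => (B n).trace) atTop (𝓝 0)

end

/-! Let `T` be the averaged step acting on kernels, so that the matrix `E[x(t) x(t)*]` equals `T^t`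
applied to `x(0) x(0)*`, and let `m_t K` be the mean entry of `T^t K`. Cayley graphs of Abelian
groups have equal in- and out-weights, so the node average is a martingale and the mean square
deviation is `m_t (x(0) x(0)*)` minus the squared initial average. By Jensen it increases in `t`,
and it is bounded. Hence it converges, and polarization gives `B`. Summing over the standard basis
yields `tr B = p - 1/N`, where `p` is the limit of `m_t` on the identity kernel. Since `tr B ≥ 0`,
only an upper bound on `p` is needed.

That bound is a drift argument (`limit_meanSecondMoment_le_of_drift`): `T` preserves order and
constants, so `T Ψ ≤ Ψ + δ - β·1` (with `1` the identity kernel) telescopes to `β p ≤ δ`. To build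
`Ψ`, take `κ` the real part of a character. By d'Alembert's equation the terms linear in the weights
multiply `κ(u - w)` by a constant; the quadratic terms live on `S - S`. After rescaling `κ`, the
drift is at most `q·1_{S-S} - κ` (`secondMomentStep_cayleyDigraph_le`). Combine such `κ` with the
coefficients of a Fejér kernel `F` of order `J`, whose constant part is `1/J`. As `F ≥ 0` everywhere
and `F` is close to `1` on `S - S` once `n` is large, `F ≥ q·1_{S-S} + ((1-q)/2)·1`, so the drift
criterion gives `(1-q)/2 · p ≤ 1/J`. Finally `J` is arbitrary. -/

/-- The probability `q` with which `u` copies a broadcast of `v`, if `u` can hear `v`. -/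
noncomputable def bgaWeight {V : Type*} (G : Digraph V) (q : ℝ) (v u : V) : ℝ :=
  open Classical in if G.Adj v u then q else 0

theorem bgaStep_apply {V : Type*} (G : Digraph V) (q : ℝ) (v : V) (x : V → ℝ) (u : V) :
    bgaStep G q v x u = x u + bgaWeight G q v u * (x v - x u) := by
  unfold bgaStep bgaWeight
  split_ifs <;> ring

theorem bgaWeight_nonneg {V : Type*} (G : Digraph V) {q : ℝ} (hq : 0 ≤ q) (v u : V) :
    0 ≤ bgaWeight G q v u := by
  unfold bgaWeight
  split_ifs <;> simp [hq]

theorem bgaWeight_le {V : Type*} (G : Digraph V) {q : ℝ} (hq : 0 ≤ q) (v u : V) :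
    bgaWeight G q v u ≤ q := by
  unfold bgaWeight
  split_ifs <;> simp [hq]

/-- Each new value is a convex combination of old ones, because the weights lie in `[0, q]` and `q ≤
1`. -/
theorem bgaStep_mono {V : Type*} (G : Digraph V) {q : ℝ} (hq : 0 ≤ q) (hq1 : q ≤ 1) (v : V)
    {x y : V → ℝ} (h : x ≤ y) : bgaStep G q v x ≤ bgaStep G q v y := by
  intro u
  rw [bgaStep_apply, bgaStep_apply]
  nlinarith [bgaWeight_nonneg G hq v u, bgaWeight_le G hq v u,
    mul_le_mul_of_nonneg_left (h v) (bgaWeight_nonneg G hq v u),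
    mul_le_mul_of_nonneg_left (h u)
      (sub_nonneg.2 ((bgaWeight_le G hq v u).trans hq1))]

theorem bgaStep_const {V : Type*} (G : Digraph V) (q : ℝ) (v : V) (c : ℝ) :
    bgaStep G q v (fun _ => c) = fun _ => c := by
  ext u
  simp [bgaStep_apply]

/-! ### Second-moment operator: order, constants and the drift criterion -/

/-- The action of one step of the Broadcast Gossip Algorithm, averaged over the broadcasting node,
on matrices of second moments. -/
noncomputable def secondMomentStep {V : Type*} [Fintype V] (G : Digraph V) (q : ℝ) :
    (V → V → ℝ) →ₗ[ℝ] (V → V → ℝ) where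
  toFun K u w := (Fintype.card V : ℝ)⁻¹ *
    ∑ v, bgaStep G q v (fun a => bgaStep G q v (K a) w) u
  map_add' K K' := by
    ext u w
    simp only [Pi.add_apply, ← mul_add, ← Finset.sum_add_distrib, bgaStep_apply]
    congr 1
    exact Finset.sum_congr rfl fun v _ => by ring
  map_smul' c K := by
    ext u w
    simp only [Pi.smul_apply, smul_eq_mul, RingHom.id_apply, bgaStep_apply, Finset.mul_sum]
    exact Finset.sum_congr rfl fun v _ => by ring

section
variable {V : Type*} [Fintype V] (G : Digraph V) (q : ℝ)

theorem secondMomentStep_apply (K : V → V → ℝ) (u w : V) :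
    secondMomentStep G q K u w = (Fintype.card V : ℝ)⁻¹ *
      ∑ v, bgaStep G q v (fun a => bgaStep G q v (K a) w) u := rfl

theorem secondMomentStep_mono {q : ℝ} (hq : 0 ≤ q) (hq1 : q ≤ 1) :
    Monotone (secondMomentStep G q) := by
  intro K K' h u w
  rw [secondMomentStep_apply, secondMomentStep_apply]
  refine mul_le_mul_of_nonneg_left (Finset.sum_le_sum fun v _ => ?_) (by positivity)
  exact bgaStep_mono G hq hq1 v (fun a => bgaStep_mono G hq hq1 v (h a) w) u

theorem secondMomentStep_const [Nonempty V] (c : ℝ) :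
    secondMomentStep G q (fun _ _ => c) = fun _ _ => c := by
  ext u w
  rw [secondMomentStep_apply]
  simp only [bgaStep_const, Finset.sum_const, Finset.card_univ, nsmul_eq_mul]
  rw [inv_mul_cancel_left₀]
  positivity

/-- The mean of the entries of the matrix that arises from `K` by `t` averaged steps. -/
noncomputable def meanSecondMoment (t : ℕ) : (V → V → ℝ) →ₗ[ℝ] ℝ where
  toFun K := (Fintype.card V : ℝ)⁻¹ ^ 2 * ∑ u, ∑ w, (secondMomentStep G q ^ t) K u w
  map_add' K K' := by
    simp only [map_add, Pi.add_apply, Finset.sum_add_distrib, mul_add]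
  map_smul' c K := by
    simp only [map_smul, Pi.smul_apply, smul_eq_mul, ← Finset.mul_sum, RingHom.id_apply]
    ring

theorem meanSecondMoment_apply (t : ℕ) (K : V → V → ℝ) : meanSecondMoment G q t K =
    (Fintype.card V : ℝ)⁻¹ ^ 2 * ∑ u, ∑ w, (secondMomentStep G q ^ t) K u w := rfl

/-- The extra step is peeled off next to `K`, so that a one-step inequality for `K` can be pushed
through `meanSecondMoment G q t`. -/
theorem meanSecondMoment_succ (t : ℕ) (K : V → V → ℝ) :
    meanSecondMoment G q (t + 1) K = meanSecondMoment G q t (secondMomentStep G q K) := by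
  simp only [meanSecondMoment_apply, pow_succ, Module.End.mul_apply]

theorem secondMomentStep_pow_mono {q : ℝ} (hq : 0 ≤ q) (hq1 : q ≤ 1) (t : ℕ) :
    Monotone ⇑(secondMomentStep G q ^ t) := by
  rw [Module.End.coe_pow]
  exact (secondMomentStep_mono G hq hq1).iterate t

theorem meanSecondMoment_mono {q : ℝ} (hq : 0 ≤ q) (hq1 : q ≤ 1) (t : ℕ) :
    Monotone (meanSecondMoment G q t) := by
  intro K K' h
  rw [meanSecondMoment_apply, meanSecondMoment_apply]
  refine mul_le_mul_of_nonneg_left (Finset.sum_le_sum fun u _ => Finset.sum_le_sum fun w _ => ?_)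
    (by positivity)
  exact secondMomentStep_pow_mono G hq hq1 t h u w

theorem meanSecondMoment_const [Nonempty V] (t : ℕ) (c : ℝ) :
    meanSecondMoment G q t (fun _ _ => c) = c := by
  induction t with
  | zero =>
    have : (Fintype.card V : ℝ) ≠ 0 := by positivity
    simp only [meanSecondMoment_apply, pow_zero, Module.End.one_apply, Finset.sum_const,
      Finset.card_univ, nsmul_eq_mul]
    field_simp
  | succ t ih => rw [meanSecondMoment_succ, secondMomentStep_const, ih]

/-- An order-preserving map that fixes constants is a contraction for the sup norm. -/
theorem abs_meanSecondMoment_le [Nonempty V] {q : ℝ} (hq : 0 ≤ q) (hq1 : q ≤ 1) (t : ℕ)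
    {K : V → V → ℝ} {C : ℝ} (hK : ∀ u w, |K u w| ≤ C) : |meanSecondMoment G q t K| ≤ C := by
  rw [abs_le]
  constructor
  · rw [← meanSecondMoment_const G q t (-C)]
    exact meanSecondMoment_mono G hq hq1 t fun u w => (abs_le.1 (hK u w)).1
  · rw [← meanSecondMoment_const G q t C]
    exact meanSecondMoment_mono G hq hq1 t fun u w => (abs_le.1 (hK u w)).2

/-- A drift criterion: the asymptotic mean of the second moment matrix started at the identity is
controlled by a kernel that decreases on average except for a small error. -/
theorem limit_meanSecondMoment_le_of_drift [Nonempty V] [DecidableEq V] {q : ℝ} (hq : 0 ≤ q)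
    (hq1 : q ≤ 1) {Ψ : V → V → ℝ} {β δ p : ℝ}
    (hΨ : ∀ u w, secondMomentStep G q Ψ u w ≤ Ψ u w + δ - β * (if u = w then 1 else 0))
    (hp : Tendsto (fun t => meanSecondMoment G q t (fun u w => if u = w then 1 else 0)) atTop
      (𝓝 p)) : β * p ≤ δ := by
  set a : ℕ → ℝ := fun t => meanSecondMoment G q t (fun u w => if u = w then 1 else 0) with ha
  obtain ⟨C, hC⟩ : ∃ C, ∀ u w, |Ψ u w| ≤ C :=
    ⟨∑ u, ∑ w, |Ψ u w|, fun u w =>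
      (Finset.single_le_sum (f := fun w => |Ψ u w|) (fun w _ => abs_nonneg _)
        (Finset.mem_univ w)).trans
      (Finset.single_le_sum (f := fun u => ∑ w, |Ψ u w|)
        (fun u _ => Finset.sum_nonneg fun w _ => abs_nonneg _) (Finset.mem_univ u))⟩
  have step (t : ℕ) : β * a t ≤
      meanSecondMoment G q t Ψ - meanSecondMoment G q (t + 1) Ψ + δ := by
    have h1 : meanSecondMoment G q t (secondMomentStep G q Ψ) ≤ meanSecondMoment G q t
        (Ψ + (fun _ _ => δ) - β • (fun u w => if u = w then 1 else 0)) :=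
      meanSecondMoment_mono G hq hq1 t fun u w => hΨ u w
    rw [map_sub, map_add, map_smul, meanSecondMoment_const, smul_eq_mul,
      ← meanSecondMoment_succ] at h1
    linarith
  -- The one-step bounds telescope. Dividing by `m` removes the boundary term `2 * C`, and Cesàro
  -- means of `a` still tend to `p`.
  have total (m : ℕ) : β * ∑ t ∈ Finset.range m, a t ≤ 2 * C + m * δ := by
    have h1 : β * ∑ t ∈ Finset.range m, a t ≤
        meanSecondMoment G q 0 Ψ - meanSecondMoment G q m Ψ + m * δ := by
      induction m with
      | zero => simp
      | succ m ih =>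
        rw [Finset.sum_range_succ, mul_add]
        push_cast
        linarith [step m]
    have h2 := abs_le.1 (abs_meanSecondMoment_le G hq hq1 0 hC)
    have h3 := abs_le.1 (abs_meanSecondMoment_le G hq hq1 m hC)
    linarith
  have lim1 : Tendsto (fun m : ℕ => β * ((m : ℝ)⁻¹ * ∑ t ∈ Finset.range m, a t)) atTop
      (𝓝 (β * p)) := hp.cesaro.const_mul β
  have lim2 : Tendsto (fun m : ℕ => 2 * C * (m : ℝ)⁻¹ + δ) atTop (𝓝 (2 * C * 0 + δ)) :=
    (tendsto_inv_atTop_nhds_zero_nat.const_mul _).add_const δ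
  rw [mul_zero, zero_add] at lim2
  refine le_of_tendsto_of_tendsto lim1 lim2 ?_
  filter_upwards [eventually_gt_atTop 0] with m hm
  have hm' : (0 : ℝ) < m := by exact_mod_cast hm
  have := mul_le_mul_of_nonneg_left (total m) (inv_nonneg.2 hm'.le)
  calc β * ((m : ℝ)⁻¹ * ∑ t ∈ Finset.range m, a t)
      = (m : ℝ)⁻¹ * (β * ∑ t ∈ Finset.range m, a t) := by ring
    _ ≤ _ := this
    _ = _ := by field_simp
end

/-! ### From the random process to second moments -/

/-- Only the draws before time `t` matter. There are finitely many outcomes of these, hence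
integrability is automatic, and they are independent of `v t`. -/
theorem exists_bgaState_eq {V : Type*} (G : Digraph V) (q : ℝ) (x₀ : V → ℝ) (t : ℕ) :
    ∃ g : (Finset.range t → V) → V → ℝ, ∀ v : ℕ → V,
      bgaState G q v x₀ t = g fun i => v i := by
  induction t with
  | zero => exact ⟨fun _ => x₀, fun _ => rfl⟩
  | succ t ih =>
    obtain ⟨g, hg⟩ := ih
    refine ⟨fun w => bgaStep G q (w ⟨t, by simp⟩)
      (g fun i => w ⟨i, by have := Finset.mem_range.1 i.2; simp; omega⟩), fun v => ?_⟩
    change bgaStep G q (v t) (bgaState G q v x₀ t) = _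
    rw [hg]

section
variable {Ω V : Type*} [MeasurableSpace Ω] [Fintype V] {μ : Measure Ω} [IsProbabilityMeasure μ]
  {v : ℕ → Ω → V}

theorem IsUniformIID.integrable_comp_bgaState (hv : IsUniformIID μ v) (G : Digraph V) (q : ℝ)
    (x₀ : V → ℝ) (t : ℕ) (F : (V → ℝ) → ℝ) :
    Integrable (fun ω => F (bgaState G q (fun s => v s ω) x₀ t)) μ := by
  let _ : MeasurableSpace V := ⊤
  obtain ⟨g, hg⟩ := exists_bgaState_eq G q x₀ t
  simp only [hg]
  have hm : Measurable fun ω (i : Finset.range t) => v i ω :=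
    measurable_pi_lambda _ fun i => hv.measurable i
  have : IsFiniteMeasure (μ.map fun ω (i : Finset.range t) => v i ω) := inferInstance
  exact (Integrable.of_finite (μ := μ.map fun ω (i : Finset.range t) => v i ω)
    (f := fun w => F (g w))).comp_measurable hm

/-- The Markov property in integrated form: split according to the value of `v t`, whose indicator
is independent of the past and has mean `1/N`. -/
theorem IsUniformIID.integral_comp_bgaState_succ (hv : IsUniformIID μ v) (G : Digraph V) (q : ℝ)
    (x₀ : V → ℝ) (t : ℕ) (F : (V → ℝ) → ℝ) :
    ∫ ω, F (bgaState G q (fun s => v s ω) x₀ (t + 1)) ∂μ =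
      ∫ ω, (Fintype.card V : ℝ)⁻¹ *
        ∑ a, F (bgaStep G q a (bgaState G q (fun s => v s ω) x₀ t)) ∂μ := by
  classical
  let _ : MeasurableSpace V := ⊤
  obtain ⟨g, hg⟩ := exists_bgaState_eq G q x₀ t
  have hind : IndepFun (fun ω (i : Finset.range t) => v i ω) (v t) μ := by
    have := (hv.indep.indepFun_finset (Finset.range t) {t} (by simp) hv.measurable).comp
      measurable_id (measurable_pi_apply (⟨t, by simp⟩ : ({t} : Finset ℕ)))
    exact this
  have hm : Measurable fun ω (i : Finset.range t) => v i ω :=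
    measurable_pi_lambda _ fun i => hv.measurable i
  have expand (ω : Ω) : F (bgaState G q (fun s => v s ω) x₀ (t + 1)) =
      ∑ a, F (bgaStep G q a (g fun i => v i ω)) * (if v t ω = a then 1 else 0) := by
    rw [← hg (fun s => v s ω)]
    simp [bgaState]
  have hint (a : V) : Integrable (fun ω => F (bgaStep G q a (g fun i => v i ω))) μ := by
    simpa only [hg] using hv.integrable_comp_bgaState G q x₀ t (fun x => F (bgaStep G q a x))
  have hpair (a : V) : IndepFun (fun ω => F (bgaStep G q a (g fun i => v i ω)))
      (fun ω => if v t ω = a then (1 : ℝ) else 0) μ :=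
    hind.comp (φ := fun w => F (bgaStep G q a (g w))) (ψ := fun b => if b = a then (1 : ℝ) else 0)
      (measurable_of_finite _) (measurable_of_finite _)
  have hint2 (a : V) : Integrable (fun ω => if v t ω = a then (1 : ℝ) else 0) μ :=
    (Integrable.of_finite (μ := μ.map (v t)) (f := fun b => if b = a then (1 : ℝ) else 0)
      ).comp_measurable (hv.measurable t)
  have hval (a : V) : ∫ ω, (if v t ω = a then (1 : ℝ) else 0) ∂μ = (Fintype.card V : ℝ)⁻¹ := by
    have h1 : (fun ω => if v t ω = a then (1 : ℝ) else 0) =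
        Set.indicator {ω | v t ω = a} (fun _ => 1) := by
      ext ω
      simp [Set.indicator_apply]
    have hms : MeasurableSet {ω | v t ω = a} :=
      hv.measurable t (MeasurableSpace.measurableSet_top (s := {a}))
    rw [h1, integral_indicator_const _ hms, smul_eq_mul, mul_one, measureReal_def, hv.uniform]
    simp
  simp only [expand, hg]
  have hprod (a : V) : Integrable (fun ω => F (bgaStep G q a (g fun i => v i ω)) *
      (if v t ω = a then (1 : ℝ) else 0)) μ := (hpair a).integrable_mul (hint a) (hint2 a)
  rw [integral_const_mul, integral_finsetSum _ fun a _ => hprod a,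
    integral_finsetSum _ fun a _ => hint a, Finset.mul_sum]
  refine Finset.sum_congr rfl fun a _ => ?_
  have := (hpair a).integral_mul_eq_mul_integral (hint a).aestronglyMeasurable
    (hint2 a).aestronglyMeasurable
  rw [hval] at this
  rw [mul_comm _ (∫ ω, _ ∂μ), ← this]
  rfl

/-- The second moments of the state evolve linearly. -/
theorem IsUniformIID.integral_bgaState_mul_bgaState (hv : IsUniformIID μ v) (G : Digraph V)
    (q : ℝ) (x₀ : V → ℝ) (t : ℕ) (u w : V) :
    ∫ ω, bgaState G q (fun s => v s ω) x₀ t u * bgaState G q (fun s => v s ω) x₀ t w ∂μ =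
      (secondMomentStep G q ^ t) (fun a b => x₀ a * x₀ b) u w := by
  induction t generalizing u w with
  | zero => simp [bgaState]
  | succ t ih =>
    rw [hv.integral_comp_bgaState_succ G q x₀ t fun x => x u * x w, pow_succ',
      Module.End.mul_apply, secondMomentStep_apply, integral_const_mul]
    have hi (a b : V) := hv.integrable_comp_bgaState G q x₀ t fun x => x a * x b
    rw [integral_finsetSum _ fun a _ => hv.integrable_comp_bgaState G q x₀ t
      fun x => bgaStep G q a x u * bgaStep G q a x w]
    congr 1
    refine Finset.sum_congr rfl fun a _ => ?_
    simp only [bgaStep_apply, ← ih]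
    set e := bgaWeight G q a
    have h1 (x : V → ℝ) : (x u + e u * (x a - x u)) * (x w + e w * (x a - x w)) =
        (1 - e u) * (1 - e w) * (x u * x w) + (1 - e u) * e w * (x u * x a) +
        e u * (1 - e w) * (x a * x w) + e u * e w * (x a * x a) := by ring
    simp only [h1]
    have h2 : Integrable (fun ω => (1 - e u) * (1 - e w) *
        (bgaState G q (fun s => v s ω) x₀ t u * bgaState G q (fun s => v s ω) x₀ t w) +
        (1 - e u) * e w *
        (bgaState G q (fun s => v s ω) x₀ t u * bgaState G q (fun s => v s ω) x₀ t a)) μ :=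
      ((hi u w).const_mul _).add ((hi u a).const_mul _)
    have h3 : Integrable (fun ω => (1 - e u) * (1 - e w) *
        (bgaState G q (fun s => v s ω) x₀ t u * bgaState G q (fun s => v s ω) x₀ t w) +
        (1 - e u) * e w *
        (bgaState G q (fun s => v s ω) x₀ t u * bgaState G q (fun s => v s ω) x₀ t a) +
        e u * (1 - e w) *
        (bgaState G q (fun s => v s ω) x₀ t a * bgaState G q (fun s => v s ω) x₀ t w)) μ :=
      h2.add ((hi a w).const_mul _)
    rw [integral_add h3 ((hi a a).const_mul _), integral_add h2 ((hi a w).const_mul _),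
      integral_add ((hi u w).const_mul _) ((hi u a).const_mul _)]
    simp only [integral_const_mul]
    ring

theorem IsUniformIID.integral_nodeAverage_sq (hv : IsUniformIID μ v) (G : Digraph V)
    (q : ℝ) (x₀ : V → ℝ) (t : ℕ) :
    ∫ ω, nodeAverage (bgaState G q (fun s => v s ω) x₀ t) ^ 2 ∂μ =
      meanSecondMoment G q t (fun a b => x₀ a * x₀ b) := by
  have hi (a b : V) := hv.integrable_comp_bgaState G q x₀ t fun x => x a * x b
  simp only [nodeAverage, mul_pow, sq (∑ u, _), Finset.sum_mul_sum]
  rw [integral_const_mul, integral_finsetSum _ fun a _ =>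
    integrable_finsetSum _ fun b _ => hi a b, meanSecondMoment_apply]
  congr 1
  refine Finset.sum_congr rfl fun a _ => ?_
  rw [integral_finsetSum _ fun b _ => hi a b]
  exact Finset.sum_congr rfl fun b _ => hv.integral_bgaState_mul_bgaState G q x₀ t a b

variable {G : Digraph V} {q : ℝ}

theorem IsUniformIID.integral_nodeAverage (hv : IsUniformIID μ v)
    (hG : ∀ x, (Fintype.card V : ℝ)⁻¹ * ∑ a, nodeAverage (bgaStep G q a x) = nodeAverage x)
    (x₀ : V → ℝ) (t : ℕ) :
    ∫ ω, nodeAverage (bgaState G q (fun s => v s ω) x₀ t) ∂μ = nodeAverage x₀ := by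
  induction t with
  | zero => simp [bgaState]
  | succ t ih =>
    rw [hv.integral_comp_bgaState_succ G q x₀ t nodeAverage]
    simp only [hG, ih]

/-- Expand the square; the cross term is known because the average is preserved in expectation. -/
theorem IsUniformIID.integral_deviation (hv : IsUniformIID μ v)
    (hG : ∀ x, (Fintype.card V : ℝ)⁻¹ * ∑ a, nodeAverage (bgaStep G q a x) = nodeAverage x)
    (x₀ : V → ℝ) (t : ℕ) :
    ∫ ω, |nodeAverage (bgaState G q (fun s => v s ω) x₀ t) - nodeAverage x₀| ^ 2 ∂μ =
      meanSecondMoment G q t (fun a b => x₀ a * x₀ b) - nodeAverage x₀ ^ 2 := by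
  have h1 (y : ℝ) : |y - nodeAverage x₀| ^ 2 =
      y ^ 2 - 2 * nodeAverage x₀ * y + nodeAverage x₀ ^ 2 := by
    rw [sq_abs]
    ring
  have hi1 := hv.integrable_comp_bgaState G q x₀ t fun x => nodeAverage x ^ 2
  have hi2 := (hv.integrable_comp_bgaState G q x₀ t nodeAverage).const_mul (2 * nodeAverage x₀)
  have hi3 : Integrable (fun ω => nodeAverage (bgaState G q (fun s => v s ω) x₀ t) ^ 2 -
      2 * nodeAverage x₀ * nodeAverage (bgaState G q (fun s => v s ω) x₀ t)) μ := hi1.sub hi2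
  simp only [h1]
  rw [integral_add hi3 (integrable_const _), integral_sub hi1 hi2, integral_const_mul,
    hv.integral_nodeAverage_sq, hv.integral_nodeAverage hG]
  simp only [integral_const, probReal_univ, one_smul]
  ring

theorem IsUniformIID.monotone_deviation [Nonempty V] (hv : IsUniformIID μ v)
    (hG : ∀ x, (Fintype.card V : ℝ)⁻¹ * ∑ a, nodeAverage (bgaStep G q a x) = nodeAverage x)
    (x₀ : V → ℝ) : Monotone fun t =>
      ∫ ω, |nodeAverage (bgaState G q (fun s => v s ω) x₀ t) - nodeAverage x₀| ^ 2 ∂μ := by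
  refine monotone_nat_of_le_succ fun t => ?_
  rw [hv.integral_comp_bgaState_succ G q x₀ t fun x => |nodeAverage x - nodeAverage x₀| ^ 2]
  refine integral_mono
    (hv.integrable_comp_bgaState G q x₀ t fun x => |nodeAverage x - nodeAverage x₀| ^ 2)
    (hv.integrable_comp_bgaState G q x₀ t fun x => (Fintype.card V : ℝ)⁻¹ *
      ∑ a, |nodeAverage (bgaStep G q a x) - nodeAverage x₀| ^ 2) fun ω => ?_
  set x := bgaState G q (fun s => v s ω) x₀ t
  have hN : (Fintype.card V : ℝ) ≠ 0 := by positivity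
  have h1 := hG x
  -- By the martingale property the current deviation is the mean of the possible next ones, so
  -- Jensen applies to the square.
  have h2 : nodeAverage x - nodeAverage x₀ = ∑ a : V, (Fintype.card V : ℝ)⁻¹ *
      (nodeAverage (bgaStep G q a x) - nodeAverage x₀) := by
    rw [← Finset.mul_sum, Finset.sum_sub_distrib, mul_sub, h1]
    simp [hN]
  simp only [sq_abs]
  rw [h2, Finset.mul_sum]
  exact (even_two.convexOn_pow (𝕜 := ℝ)).map_sum_le (fun _ _ => by positivity) (by simp [hN])
    fun _ _ => Set.mem_univ _

theorem IsUniformIID.exists_tendsto_meanSecondMoment [Nonempty V] (hv : IsUniformIID μ v)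
    (hq : 0 ≤ q) (hq1 : q ≤ 1)
    (hG : ∀ x, (Fintype.card V : ℝ)⁻¹ * ∑ a, nodeAverage (bgaStep G q a x) = nodeAverage x)
    (x : V → ℝ) :
    ∃ l, Tendsto (fun t => meanSecondMoment G q t (fun a b => x a * x b)) atTop (𝓝 l) := by
  have hmono : Monotone fun t => meanSecondMoment G q t (fun a b => x a * x b) := by
    intro s t hst
    have := hv.monotone_deviation hG x hst
    simp only [hv.integral_deviation hG] at this
    simpa using this
  set C := ∑ u, |x u|
  have hC (u : V) : |x u| ≤ C :=
    Finset.single_le_sum (f := fun u => |x u|) (fun u _ => abs_nonneg _) (Finset.mem_univ u)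
  refine ⟨_, tendsto_atTop_ciSup hmono ⟨C * C, ?_⟩⟩
  rintro _ ⟨t, rfl⟩
  refine (le_abs_self _).trans (abs_meanSecondMoment_le G hq hq1 t fun u w => ?_)
  rw [abs_mul]
  exact mul_le_mul (hC u) (hC w) (abs_nonneg _) ((abs_nonneg _).trans (hC u))

/-- If the node average is preserved on average, then a bias matrix exists. -/
theorem IsUniformIID.exists_isBiasMatrix [Nonempty V] (hv : IsUniformIID μ v)
    (hq : 0 ≤ q) (hq1 : q ≤ 1)
    (hG : ∀ x, (Fintype.card V : ℝ)⁻¹ * ∑ a, nodeAverage (bgaStep G q a x) = nodeAverage x) :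
    ∃ B : Matrix V V ℝ, IsBiasMatrix μ (fun x₀ t ω => bgaState G q (fun s => v s ω) x₀ t) B := by
  classical
  set Λ := meanSecondMoment G q
  choose l hl using hv.exists_tendsto_meanSecondMoment hq hq1 hG
  let e (u : V) : V → ℝ := Pi.single u 1
  -- Polarization: a symmetrized matrix unit is a combination of rank-one kernels, for which
  -- convergence is known.
  let E (u w : V) : V → V → ℝ := (2 : ℝ)⁻¹ • ((fun a b => (e u + e w) a * (e u + e w) b) -
    (fun a b => e u a * e u b) - fun a b => e w a * e w b)
  have hE (u w : V) : Tendsto (fun t => Λ t (E u w)) atTop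
      (𝓝 ((2 : ℝ)⁻¹ * (l (e u + e w) - l (e u) - l (e w)))) := by
    simp only [E, map_smul, map_sub, smul_eq_mul]
    exact (((hl _).sub (hl _)).sub (hl _)).const_mul _
  have hx (x : V → ℝ) : (fun a b => x a * x b) = ∑ u, ∑ w, (x u * x w) • E u w := by
    ext a b
    have h1 (u w : V) : E u w a b = (2 : ℝ)⁻¹ * (e u a * e w b + e w a * e u b) := by
      simp only [E, Pi.smul_apply, Pi.sub_apply, Pi.add_apply, smul_eq_mul]
      ring
    simp only [Finset.sum_apply, Pi.smul_apply, h1, smul_eq_mul, mul_add, Finset.sum_add_distrib]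
    simp only [e, Pi.single_apply]
    simp [Finset.sum_ite_eq, mul_ite]
    ring
  refine ⟨fun u w => (2 : ℝ)⁻¹ * (l (e u + e w) - l (e u) - l (e w)) -
    (Fintype.card V : ℝ)⁻¹ ^ 2, fun x => ?_⟩
  simp only [hv.integral_deviation hG]
  have h1 : Tendsto (fun t => Λ t (fun a b => x a * x b)) atTop
      (𝓝 (∑ u, ∑ w, (x u * x w) * ((2 : ℝ)⁻¹ * (l (e u + e w) - l (e u) - l (e w))))) := by
    simp only [hx x, map_sum, map_smul, smul_eq_mul]
    exact tendsto_finsetSum _ fun u _ => tendsto_finsetSum _ fun w _ => (hE u w).const_mul _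
  convert h1.sub_const (nodeAverage x ^ 2) using 2
  have h2 : nodeAverage x ^ 2 = ∑ u, ∑ w, x u * x w * (Fintype.card V : ℝ)⁻¹ ^ 2 := by
    rw [nodeAverage, mul_pow, sq (∑ u, x u), Finset.sum_mul_sum, Finset.mul_sum]
    refine Finset.sum_congr rfl fun u _ => ?_
    rw [Finset.mul_sum]
    exact Finset.sum_congr rfl fun w _ => by ring
  rw [h2]
  simp only [dotProduct, Matrix.mulVec, Finset.mul_sum, ← Finset.sum_sub_distrib]
  exact Finset.sum_congr rfl fun u _ => Finset.sum_congr rfl fun w _ => by ring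

/-- The trace of a bias matrix in terms of the second moments started at the identity. -/
theorem IsBiasMatrix.tendsto_trace [Nonempty V] [DecidableEq V] (hv : IsUniformIID μ v)
    (hG : ∀ x, (Fintype.card V : ℝ)⁻¹ * ∑ a, nodeAverage (bgaStep G q a x) = nodeAverage x)
    {B : Matrix V V ℝ}
    (hB : IsBiasMatrix μ (fun x₀ t ω => bgaState G q (fun s => v s ω) x₀ t) B) :
    Tendsto (fun t => meanSecondMoment G q t (fun u w => if u = w then 1 else 0)) atTop
      (𝓝 (B.trace + (Fintype.card V : ℝ)⁻¹)) := by
  let e (u : V) : V → ℝ := Pi.single u 1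
  have hid : (fun u w : V => if u = w then (1 : ℝ) else 0) = ∑ c, fun a b => e c a * e c b := by
    ext a b
    simp [e, Pi.single_apply, Finset.sum_apply, eq_comm]
  have h1 (c : V) : Tendsto (fun t => meanSecondMoment G q t (fun a b => e c a * e c b)) atTop
      (𝓝 (B c c + (Fintype.card V : ℝ)⁻¹ ^ 2)) := by
    have := (hB (e c)).add_const (nodeAverage (e c) ^ 2)
    simp only [hv.integral_deviation hG, sub_add_cancel] at this
    simpa [e, nodeAverage, Matrix.mulVec, dotProduct, Pi.single_apply] using this
  have h2 := tendsto_finsetSum Finset.univ fun c _ => h1 c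
  rw [hid]
  simp only [map_sum]
  convert h2 using 2
  have hN : (Fintype.card V : ℝ) ≠ 0 := by positivity
  rw [Finset.sum_add_distrib, Finset.sum_const, Finset.card_univ, nsmul_eq_mul, Matrix.trace]
  simp only [Matrix.diag_apply]
  field_simp

end

theorem IsBiasMatrix.trace_nonneg {Ω V : Type*} [MeasurableSpace Ω] [Fintype V] {μ : Measure Ω}
    {x : (V → ℝ) → ℕ → Ω → V → ℝ} {B : Matrix V V ℝ}
    (hB : IsBiasMatrix μ x B) : 0 ≤ B.trace := by
  classical
  refine Finset.sum_nonneg fun c _ => ?_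
  have h1 : 0 ≤ (Pi.single c 1 : V → ℝ) ⬝ᵥ B.mulVec (Pi.single c 1) :=
    ge_of_tendsto' (hB _) fun t => integral_nonneg fun ω => by positivity
  simpa using h1

/-! ### Drift of translation-invariant kernels on finite Abelian groups -/

/-- The weight `q` on the generators of a Cayley graph. -/
noncomputable def generatorWeight {A : Type*} (S : Set A) (q : ℝ) (s : A) : ℝ :=
  open Classical in if s ∈ S then q else 0

theorem generatorWeight_nonneg {A : Type*} (S : Set A) {q : ℝ} (hq : 0 ≤ q) (s : A) :
    0 ≤ generatorWeight S q s := by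
  unfold generatorWeight
  split_ifs <;> simp [hq]

theorem bgaWeight_cayleyDigraph {A : Type*} [AddGroup A] (S : Set A) (q : ℝ) (v u : A) :
    bgaWeight (cayleyDigraph S) q v u = generatorWeight S q (u - v) := rfl

section
variable {A : Type*} [AddCommGroup A] [Fintype A] (S : Set A)

/-- Cayley graphs of Abelian groups are balanced, so the node average is preserved on average. -/
theorem sum_nodeAverage_bgaStep_cayleyDigraph (q : ℝ) (x : A → ℝ) :
    (Fintype.card A : ℝ)⁻¹ * ∑ a, nodeAverage (bgaStep (cayleyDigraph S) q a x) =
      nodeAverage x := by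
  have hN : (Fintype.card A : ℝ) ≠ 0 := by positivity
  set e := generatorWeight S q
  have h1 : ∑ a, ∑ u, e (u - a) * x a = (∑ s, e s) * ∑ a, x a := by
    rw [Finset.sum_mul_sum, Finset.sum_comm]
    rw [Finset.sum_comm (s := Finset.univ) (t := Finset.univ) (f := fun s a => e s * x a),
      Finset.sum_comm]
    exact Finset.sum_congr rfl fun a _ => (Equiv.subRight a).sum_comp fun s => e s * x a
  -- Incoming weight at a node: for fixed `u`, the difference `u - a` also runs once through the
  -- group.
  have h2 : ∑ a, ∑ u, e (u - a) * x u = (∑ s, e s) * ∑ a, x a := by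
    rw [Finset.sum_mul_sum, Finset.sum_comm,
      Finset.sum_comm (s := Finset.univ) (t := Finset.univ) (f := fun s a => e s * x a)]
    exact Finset.sum_congr rfl fun a _ => (Equiv.subLeft a).sum_comp fun s => e s * x a
  simp only [nodeAverage, bgaStep_apply, bgaWeight_cayleyDigraph, mul_sub,
    Finset.sum_add_distrib, Finset.sum_sub_distrib, mul_add, ← Finset.mul_sum]
  rw [h1, h2]
  simp [hN]

/-- How one averaged step acts on the translation invariant kernel of a positive definite
function satisfying d'Alembert's equation. -/
theorem secondMomentStep_cayleyDigraph_le {q : ℝ} (hq : 0 ≤ q) {κ : A → ℝ} (h0 : κ 0 = 1)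
    (hle : ∀ a, κ a ≤ 1) (hneg : ∀ a, κ (-a) = κ a)
    (hadd : ∀ a b, κ (a + b) + κ (a - b) = 2 * κ a * κ b) {p : A → ℝ}
    (hp0 : ∀ a, 0 ≤ p a) (hp : ∀ s ∈ S, ∀ s' ∈ S, p (s - s') = 1) (u w : A) :
    secondMomentStep (cayleyDigraph S) q (fun a b => κ (a - b)) u w ≤ κ (u - w) +
      (Fintype.card A : ℝ)⁻¹ * (2 * ∑ s, generatorWeight S q s * (1 - κ s)) *
        (q * p (u - w) - κ (u - w)) := by
  have hN : (Fintype.card A : ℝ) ≠ 0 := by positivity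
  rw [secondMomentStep_apply]
  simp only [bgaStep_apply, bgaWeight_cayleyDigraph, sub_self, h0]
  set e := generatorWeight S q with he
  set D := ∑ s, e s * (1 - κ s) with hD
  have hpair (v : A) : e (u - v) * e (w - v) ≤ q * p (u - w) * e (u - v) ∧
      e (u - v) * e (w - v) ≤ q * p (u - w) * e (w - v) := by
    by_cases hu : u - v ∈ S
    · by_cases hw : w - v ∈ S
      · have := hp _ hu _ hw
        rw [sub_sub_sub_cancel_right] at this
        simp [he, generatorWeight, hu, hw, this]
      · have h1 : e (w - v) = 0 := if_neg hw
        rw [h1, mul_zero, mul_zero]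
        exact ⟨mul_nonneg (mul_nonneg hq (hp0 _)) (generatorWeight_nonneg _ hq _), le_rfl⟩
    · have h1 : e (u - v) = 0 := if_neg hu
      rw [h1, zero_mul, mul_zero]
      exact ⟨le_rfl, mul_nonneg (mul_nonneg hq (hp0 _)) (generatorWeight_nonneg _ hq _)⟩
  have hsum (y : A) (f : A → ℝ) : ∑ v, f (y - v) = ∑ s, f s := (Equiv.subLeft y).sum_comp f
  -- The cross term is `e (u - v) * e (w - v)` times `(1 - κ (u - v)) + (1 - κ (w - v)) - (1 - κ (u
  -- - w))`. The last part is dropped (`h4`), and `hpair` bounds the other two by terms linear in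
  -- `e`.
  have hbound (v : A) :
      κ (u - w) + e (u - v) * (κ (v - w) - κ (u - w)) + e (w - v) * (κ (u - v) - κ (u - w)) +
        q * p (u - w) * (e (u - v) * (1 - κ (u - v)) + e (w - v) * (1 - κ (w - v))) ≥
      κ (u - w) + e (w - v) * (κ (u - v) - κ (u - w)) +
        e (u - v) * (κ (v - w) + e (w - v) * (1 - κ (v - w)) -
          (κ (u - w) + e (w - v) * (κ (u - v) - κ (u - w)))) := by
    have h1 := mul_le_mul_of_nonneg_right (hpair v).1 (sub_nonneg.2 (hle (u - v)))
    have h2 := mul_le_mul_of_nonneg_right (hpair v).2 (sub_nonneg.2 (hle (w - v)))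
    have h3 : κ (v - w) = κ (w - v) := by rw [← hneg, neg_sub]
    have h4 : 0 ≤ e (u - v) * e (w - v) * (1 - κ (u - w)) :=
      mul_nonneg (mul_nonneg (generatorWeight_nonneg _ hq _) (generatorWeight_nonneg _ hq _))
        (sub_nonneg.2 (hle _))
    rw [h3]
    nlinarith
  have hs1 : ∑ v, e (u - v) * (κ (v - w) - κ (u - w)) = ∑ s, e s * (κ (u - w - s) - κ (u - w)) := by
    rw [← hsum u fun s => e s * (κ (u - w - s) - κ (u - w))]
    exact Finset.sum_congr rfl fun v _ => by congr 3; abel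
  have hs2 : ∑ v, e (w - v) * (κ (u - v) - κ (u - w)) = ∑ s, e s * (κ (u - w + s) - κ (u - w)) := by
    rw [← hsum w fun s => e s * (κ (u - w + s) - κ (u - w))]
    exact Finset.sum_congr rfl fun v _ => by congr 3; abel
  -- D'Alembert's equation makes `κ` an eigenfunction of the symmetrized generator.
  have hs3 : ∑ s, e s * (κ (u - w - s) - κ (u - w)) + ∑ s, e s * (κ (u - w + s) - κ (u - w)) =
      -(2 * D * κ (u - w)) := by
    rw [← Finset.sum_add_distrib, hD, Finset.mul_sum, Finset.sum_mul, ← Finset.sum_neg_distrib]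
    refine Finset.sum_congr rfl fun s _ => ?_
    linear_combination e s * hadd (u - w) s
  calc _ ≤ (Fintype.card A : ℝ)⁻¹ * ∑ v, (κ (u - w) + e (u - v) * (κ (v - w) - κ (u - w)) +
        e (w - v) * (κ (u - v) - κ (u - w)) +
        q * p (u - w) * (e (u - v) * (1 - κ (u - v)) + e (w - v) * (1 - κ (w - v)))) :=
        mul_le_mul_of_nonneg_left (Finset.sum_le_sum fun v _ => hbound v) (by positivity)
    _ = (Fintype.card A : ℝ)⁻¹ * (Fintype.card A * κ (u - w) - 2 * D * κ (u - w) +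
        q * p (u - w) * (D + D)) := by
        rw [Finset.sum_add_distrib, Finset.sum_add_distrib, Finset.sum_add_distrib,
          ← Finset.mul_sum, Finset.sum_add_distrib, hsum u fun s => e s * (1 - κ s),
          hsum w fun s => e s * (1 - κ s), hs1, hs2, add_assoc (∑ v : A, κ (u - w)), hs3]
        simp only [Finset.sum_const, Finset.card_univ, nsmul_eq_mul]
        ring
    _ = _ := by
        field_simp
        ring

/-- A weighted version of the drift criterion for Cayley graphs: if a nonnegative combination of
d'Alembert functions is nonnegative and close to `1` on the differences of generators, then the
asymptotic mean of the second moment matrix is controlled by its constant part. -/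
theorem limit_meanSecondMoment_cayleyDigraph_le [DecidableEq A] {q : ℝ} (hq : 0 < q)
    (hq1 : q < 1) {ι : Type*} (I : Finset ι) (b : ι → ℝ) (hb : ∀ i ∈ I, 0 ≤ b i) {b₀ : ℝ}
    (hsum : b₀ + ∑ i ∈ I, b i = 1) (hb₀ : 0 ≤ b₀) {κ : ι → A → ℝ} (h0 : ∀ i ∈ I, κ i 0 = 1)
    (hle : ∀ i ∈ I, ∀ a, κ i a ≤ 1) (hneg : ∀ i ∈ I, ∀ a, κ i (-a) = κ i a)
    (hadd : ∀ i ∈ I, ∀ a b, κ i (a + b) + κ i (a - b) = 2 * κ i a * κ i b)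
    (hlt : ∀ i ∈ I, ∃ s ∈ S, κ i s ≠ 1)
    (hpos : ∀ a, 0 ≤ b₀ + ∑ i ∈ I, b i * κ i a) (hS : S.Nonempty) {η : ℝ}
    (hη : η ≤ 1 - q)
    (hnear : ∀ s ∈ S, ∀ s' ∈ S, 1 - η ≤ b₀ + ∑ i ∈ I, b i * κ i (s - s')) {p : ℝ}
    (hp : Tendsto (fun t => meanSecondMoment (cayleyDigraph S) q t
      (fun u w => if u = w then 1 else 0)) atTop (𝓝 p)) :
    (1 - q - η) * p ≤ b₀ := by
  classical
  have hN : (0 : ℝ) < Fintype.card A := by positivity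
  let e := generatorWeight S q
  let D (i : ι) : ℝ := 2 * ∑ s, e s * (1 - κ i s)
  have hD : ∀ i ∈ I, 0 < D i := by
    intro i hi
    obtain ⟨s, hs, hs1⟩ := hlt i hi
    have hes : e s = q := by simp [e, generatorWeight, hs]
    refine mul_pos two_pos (Finset.sum_pos' (fun a _ => mul_nonneg (generatorWeight_nonneg _ hq.le _)
      (sub_nonneg.2 (hle i hi a))) ⟨s, Finset.mem_univ _, ?_⟩)
    rw [hes]
    exact mul_pos hq (sub_pos.2 ((hle i hi s).lt_of_ne hs1))
  let W (a : A) : ℝ := if ∃ s ∈ S, ∃ s' ∈ S, a = s - s' then 1 else 0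
  have hW0 (a : A) : 0 ≤ W a := by
    simp only [W]
    split_ifs <;> simp
  have hW1 : ∀ s ∈ S, ∀ s' ∈ S, W (s - s') = 1 := fun s hs s' hs' =>
    if_pos ⟨s, hs, s', hs', rfl⟩
  -- The factor `N / D i` cancels the speed of each `κ i`, so that the drifts add up with weights `b
  -- i`.
  let Ψ : A → A → ℝ := ∑ i ∈ I, (b i * (Fintype.card A / D i)) • fun u w => κ i (u - w)
  refine limit_meanSecondMoment_le_of_drift (cayleyDigraph S) hq.le hq1.le (Ψ := Ψ) ?_ hp
  intro u w
  have h1 : secondMomentStep (cayleyDigraph S) q Ψ u w ≤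
      Ψ u w + ∑ i ∈ I, b i * (q * W (u - w) - κ i (u - w)) := by
    simp only [Ψ, map_sum, map_smul, Finset.sum_apply, Pi.smul_apply, smul_eq_mul]
    rw [← Finset.sum_add_distrib]
    refine Finset.sum_le_sum fun i hi => ?_
    have h2 := secondMomentStep_cayleyDigraph_le S hq.le (h0 i hi) (hle i hi) (hneg i hi)
      (hadd i hi) hW0 hW1 u w
    have h3 : 0 ≤ b i * (Fintype.card A / D i) :=
      mul_nonneg (hb i hi) (div_nonneg hN.le (hD i hi).le)
    refine (mul_le_mul_of_nonneg_left h2 h3).trans_eq ?_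
    have h4 : D i ≠ 0 := (hD i hi).ne'
    change b i * (Fintype.card A / D i) * (κ i (u - w) + (Fintype.card A : ℝ)⁻¹ * D i *
      (q * W (u - w) - κ i (u - w))) = _
    field_simp
  have h2 : ∑ i ∈ I, b i * (q * W (u - w) - κ i (u - w)) =
      (1 - b₀) * (q * W (u - w)) - ∑ i ∈ I, b i * κ i (u - w) := by
    rw [← hsum, add_sub_cancel_left, Finset.sum_mul, ← Finset.sum_sub_distrib]
    exact Finset.sum_congr rfl fun i _ => by ring
  have h3 : 0 ≤ b₀ * (q * W (u - w)) := mul_nonneg hb₀ (mul_nonneg hq.le (hW0 _))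
  obtain ⟨s₀, hs₀⟩ := hS
  -- On the diagonal `W 0 = 1` and the left side is exactly `1 - η`; elsewhere on `S - S` it is `q ≤
  -- 1 - η`; off `S - S` it is `0`.
  have h4 : q * W (u - w) + (1 - q - η) * (if u = w then 1 else 0) ≤
      b₀ + ∑ i ∈ I, b i * κ i (u - w) := by
    split_ifs with huw
    · have h5 := hnear s₀ hs₀ s₀ hs₀
      have h6 := hW1 s₀ hs₀ s₀ hs₀
      rw [sub_self] at h5 h6
      rw [huw, sub_self, h6]
      linarith
    · rw [mul_zero, add_zero]
      by_cases hW : ∃ s ∈ S, ∃ s' ∈ S, u - w = s - s'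
      · obtain ⟨s, hs, s', hs', h⟩ := hW
        rw [h, hW1 s hs s' hs']
        linarith [hnear s hs s' hs']
      · simp only [W, if_neg hW, mul_zero]
        exact hpos _
  linarith
end

/-! ### Characters and the Fejér kernel -/

theorem AddChar.re_add_re_sub {A : Type*} [AddCommGroup A] [Finite A] (ψ : AddChar A ℂ) (a b : A) :
    (ψ (a + b)).re + (ψ (a - b)).re = 2 * (ψ a).re * (ψ b).re := by
  rw [sub_eq_add_neg, ψ.map_add_eq_mul, ψ.map_add_eq_mul, ψ.map_neg_eq_conj]
  simp only [Complex.mul_re, Complex.conj_re, Complex.conj_im]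
  ring

theorem AddChar.eq_one_of_re_eq_one {A : Type*} [AddCommGroup A] [Finite A] (ψ : AddChar A ℂ)
    {a : A} (h : (ψ a).re = 1) : ψ a = 1 := by
  have h1 := Complex.sq_norm (ψ a)
  rw [ψ.norm_apply, Complex.normSq_apply, h] at h1
  have h2 : (ψ a).im = 0 := by
    have : (ψ a).im * (ψ a).im = 0 := by linarith
    exact mul_self_eq_zero.1 this
  exact Complex.ext h h2

/-- The Fejér kernel is nonnegative. -/
theorem AddChar.sum_re_sub_nonneg {A : Type*} [AddCommGroup A] [Finite A] (ψ : AddChar A ℂ)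
    {ι : Type*} (s : Finset ι) (f : ι → A) :
    0 ≤ ∑ p ∈ s ×ˢ s, (ψ (f p.1 - f p.2)).re := by
  have h : ∑ p ∈ s ×ˢ s, (ψ (f p.1 - f p.2)).re = Complex.normSq (∑ i ∈ s, ψ (f i)) := by
    rw [← Complex.ofReal_re (Complex.normSq _), Complex.normSq_eq_conj_mul_self, mul_comm,
      map_sum, Finset.sum_mul_sum, ← Finset.sum_product', Complex.re_sum]
    refine Finset.sum_congr rfl fun p _ => ?_
    rw [sub_eq_add_neg, ψ.map_add_eq_mul, ψ.map_neg_eq_conj]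
  rw [h]
  exact Complex.normSq_nonneg _

/-- Splits a Fejér kernel into its constant part, from the diagonal, and the nonconstant
frequencies. -/
theorem Finset.inv_card_add_sum_offDiag {ι : Type*} [DecidableEq ι] (s : Finset ι)
    (hs : s.Nonempty) (F : ι × ι → ℝ) (hF : ∀ i, F (i, i) = 1) :
    (s.card : ℝ)⁻¹ + ∑ p ∈ s.offDiag, (s.card : ℝ)⁻¹ ^ 2 * F p =
      (s.card : ℝ)⁻¹ ^ 2 * ∑ p ∈ s ×ˢ s, F p := by
  have hN : (s.card : ℝ) ≠ 0 := by simpa using hs.ne_empty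
  rw [← s.diag_union_offDiag, Finset.sum_union (s.disjoint_diag_offDiag), mul_add,
    ← Finset.mul_sum, Finset.sum_diag]
  simp only [hF, Finset.sum_const, nsmul_eq_mul]
  field_simp

/-- The real part of the `m`-th character of `ℤ / M`, evaluated at the `i`-th coordinate. -/
noncomputable def coordinateCos {d : ℕ} (M : ℕ) [NeZero M] (i : Fin d) (m : ℤ)
    (u : Fin d → ZMod M) : ℝ :=
  (ZMod.stdAddChar (N := M) (m * u i)).re

theorem coordinateCos_intCast {d : ℕ} (M : ℕ) [NeZero M] (i : Fin d) (m : ℤ) (s s' : Fin d → ℤ) :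
    coordinateCos M i m ((fun i => (s i : ZMod M)) - fun i => (s' i : ZMod M)) =
      Real.cos (2 * Real.pi * (m * (s i - s' i)) * (M : ℝ)⁻¹) := by
  have h : ((m : ZMod M) * ((s i : ZMod M) - (s' i : ZMod M))) =
      ((m * (s i - s' i) : ℤ) : ZMod M) := by push_cast; ring
  rw [coordinateCos, Pi.sub_apply, h, ZMod.stdAddChar_coe, ← Complex.exp_ofReal_mul_I_re]
  congr 2
  push_cast
  ring

/-- Along the odd moduli, the coordinate functions of any fixed finite set of frequencies tend to
be close to `1` on differences of generators. -/
theorem eventually_le_coordinateCos {d : ℕ} (S : Finset (Fin d → ℤ)) (i : Fin d) (J : ℕ) {c : ℝ}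
    (hc : c < 1) : ∀ᶠ n : ℕ in atTop, ∀ p ∈ Finset.range J ×ˢ Finset.range J, ∀ s ∈ S, ∀ s' ∈ S,
      c ≤ coordinateCos (2 * n + 1) i ((p.1 : ℤ) - p.2)
        ((fun i => (s i : ZMod (2 * n + 1))) - fun i => (s' i : ZMod (2 * n + 1))) := by
  rw [Filter.eventually_all_finset]
  intro p _
  rw [Filter.eventually_all_finset]
  intro s _
  rw [Filter.eventually_all_finset]
  intro s' _
  simp only [coordinateCos_intCast]
  have h1 : Tendsto (fun n : ℕ => 2 * n + 1) atTop atTop :=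
    tendsto_atTop_mono (fun n => show n ≤ 2 * n + 1 by omega) tendsto_id
  have h2 : Tendsto (fun n : ℕ => Real.cos (2 * Real.pi *
      (((p.1 : ℤ) - (p.2 : ℤ) : ℤ) * ((s i : ℝ) - s' i)) * ((2 * n + 1 : ℕ) : ℝ)⁻¹)) atTop
      (𝓝 (Real.cos (2 * Real.pi *
        (((p.1 : ℤ) - (p.2 : ℤ) : ℤ) * ((s i : ℝ) - s' i)) * 0))) :=
    (Real.continuous_cos.tendsto _).comp
      ((tendsto_inv_atTop_nhds_zero_nat.comp h1).const_mul _)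
  rw [mul_zero, Real.cos_zero] at h2
  exact (h2.eventually (lt_mem_nhds hc)).mono fun n hn => hn.le

theorem exists_apply_ne_zero_of_closure_eq_top {d : ℕ} {S : Set (Fin d → ℤ)}
    (hS : AddSubgroup.closure S = ⊤) (i : Fin d) : ∃ s ∈ S, s i ≠ 0 := by
  by_contra! h
  have h1 : AddSubgroup.closure S ≤ (Pi.evalAddMonoidHom (fun _ : Fin d => ℤ) i).ker :=
    (AddSubgroup.closure_le _).2 fun s hs => h s hs
  have h2 : (fun _ => 1 : Fin d → ℤ) ∈ AddSubgroup.closure S := hS ▸ AddSubgroup.mem_top _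
  have h3 : (1 : ℤ) = 0 := h1 h2
  exact one_ne_zero h3

/-- For large `n` the asymptotic mean of the second moment matrix started at the identity is at
most a constant times the constant part of a Fejér kernel. -/
theorem eventually_limit_meanSecondMoment_le {d : ℕ} (S : Finset (Fin d → ℤ)) (i : Fin d)
    (hS : ∃ s ∈ S, s i ≠ 0) {q : ℝ} (hq : 0 < q) (hq1 : q < 1) {J : ℕ} (hJ : 0 < J) :
    ∀ᶠ n : ℕ in atTop, ∀ p : ℝ, Tendsto (fun t => meanSecondMoment (latticeCayleyDigraph S n) q t
      (fun u w => if u = w then 1 else 0)) atTop (𝓝 p) → (1 - q) / 2 * p ≤ (J : ℝ)⁻¹ := by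
  obtain ⟨s₀, hs₀, hi⟩ := hS
  have hc : 1 - (1 - q) / 2 < 1 := by linarith
  -- The second condition puts `s₀` in the box. The third excludes wrap-around: a nonzero frequency
  -- difference times `s₀ i` has absolute value at most `n < 2 * n + 1`, so its character is
  -- nontrivial at `s₀`.
  filter_upwards [eventually_le_coordinateCos S i J hc,
    eventually_ge_atTop (∑ k, (s₀ k).natAbs), eventually_ge_atTop (J * (s₀ i).natAbs)]
    with n hn hn1 hn2 p hp
  have hs₀n : (fun i => (s₀ i : ZMod (2 * n + 1))) ∈ latticeGenerators S n := by
    refine ⟨s₀, ⟨hs₀, fun k => ?_⟩, rfl⟩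
    have : (s₀ k).natAbs ≤ n := (Finset.single_le_sum (f := fun k => (s₀ k).natAbs)
      (fun _ _ => Nat.zero_le _) (Finset.mem_univ k)).trans hn1
    rw [Int.abs_eq_natAbs]
    exact_mod_cast this
  let I := (Finset.range J).offDiag
  let κ (x : ℕ × ℕ) : (Fin d → ZMod (2 * n + 1)) → ℝ :=
    coordinateCos (2 * n + 1) i ((x.1 : ℤ) - x.2)
  have hJ' : (0 : ℝ) < J := by exact_mod_cast hJ
  have hne : (Finset.range J).Nonempty := Finset.nonempty_range_iff.2 hJ.ne'
  have htotal (F : ℕ × ℕ → ℝ) (hF : ∀ j, F (j, j) = 1) : (J : ℝ)⁻¹ + ∑ x ∈ I, (J : ℝ)⁻¹ ^ 2 * F x =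
      (J : ℝ)⁻¹ ^ 2 * ∑ x ∈ Finset.range J ×ˢ Finset.range J, F x := by
    simpa using Finset.inv_card_add_sum_offDiag _ hne F hF
  have hκ0 (x : ℕ × ℕ) : κ x 0 = 1 := by simp [κ, coordinateCos]
  have hdiag (a : Fin d → ZMod (2 * n + 1)) (j : ℕ) : κ (j, j) a = 1 := by
    simp [κ, coordinateCos]
  have hfejer (a : Fin d → ZMod (2 * n + 1)) : (J : ℝ)⁻¹ + ∑ x ∈ I, (J : ℝ)⁻¹ ^ 2 * κ x a =
      (J : ℝ)⁻¹ ^ 2 * ∑ x ∈ Finset.range J ×ˢ Finset.range J, κ x a :=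
    htotal (fun x => κ x a) (hdiag a)
  have key := limit_meanSecondMoment_cayleyDigraph_le (latticeGenerators S n) hq hq1 I
    (fun _ => (J : ℝ)⁻¹ ^ 2) (fun _ _ => by positivity) (b₀ := (J : ℝ)⁻¹) (κ := κ)
    (η := (1 - q) / 2) (p := p)
    (hsum := by
      have := htotal (fun _ => 1) fun _ => rfl
      simp only [mul_one] at this
      rw [this]
      simp only [Finset.sum_const, Finset.card_product, Finset.card_range, nsmul_eq_mul]
      push_cast
      field_simp)
    (hb₀ := by positivity)
    (h0 := fun x _ => hκ0 x)
    (hle := fun x _ a => (Complex.re_le_norm _).trans (AddChar.norm_apply _ _).le)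
    (hneg := fun x _ a => by
      simp only [κ, coordinateCos, Pi.neg_apply, mul_neg, AddChar.map_neg_eq_conj,
        Complex.conj_re])
    (hadd := fun x _ a b => by
      simp only [κ, coordinateCos, Pi.add_apply, Pi.sub_apply, mul_add, mul_sub]
      exact AddChar.re_add_re_sub _ _ _)
    (hlt := fun x hx => by
      refine ⟨_, hs₀n, fun h => ?_⟩
      obtain ⟨hx1, hx2, hx3⟩ := Finset.mem_offDiag.1 hx
      rw [Finset.mem_range] at hx1 hx2
      have h1 := AddChar.eq_one_of_re_eq_one _ h
      rw [← AddChar.map_zero_eq_one (ZMod.stdAddChar (N := 2 * n + 1))] at h1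
      have h2 := ZMod.injective_stdAddChar h1
      have h3 : ((((x.1 : ℤ) - x.2) * s₀ i : ℤ) : ZMod (2 * n + 1)) = 0 := by
        rw [← h2]
        push_cast
        ring
      rw [ZMod.intCast_zmod_eq_zero_iff_dvd] at h3
      have h4 : ((x.1 : ℤ) - x.2) * s₀ i = 0 := by
        refine Int.eq_zero_of_abs_lt_dvd h3 ?_
        rw [abs_mul]
        have h5 : |(x.1 : ℤ) - x.2| ≤ J := by rw [abs_le]; omega
        have h6 := mul_le_mul_of_nonneg_right h5 (abs_nonneg (s₀ i))
        have h7 : (J : ℤ) * |s₀ i| ≤ n := by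
          rw [Int.abs_eq_natAbs]
          exact_mod_cast hn2
        push_cast
        omega
      rcases mul_eq_zero.1 h4 with h5 | h5
      · omega
      · exact hi h5)
    (hpos := fun a => by
      rw [hfejer]
      refine mul_nonneg (by positivity) ?_
      have := AddChar.sum_re_sub_nonneg (ZMod.stdAddChar (N := 2 * n + 1)) (Finset.range J)
        fun j => (j : ZMod (2 * n + 1)) * a i
      refine this.trans_eq (Finset.sum_congr rfl fun x _ => ?_)
      simp [κ, coordinateCos, sub_mul])
    ⟨_, hs₀n⟩ (by linarith)
    (hnear := by
      rintro _ ⟨s, ⟨hs, -⟩, rfl⟩ _ ⟨s', ⟨hs', -⟩, rfl⟩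
      rw [hfejer]
      have h1 : ∑ x ∈ Finset.range J ×ˢ Finset.range J, (1 - (1 - q) / 2) ≤
          ∑ x ∈ Finset.range J ×ˢ Finset.range J, κ x
            ((fun i => (s i : ZMod (2 * n + 1))) - fun i => (s' i : ZMod (2 * n + 1))) :=
        Finset.sum_le_sum fun x hx => hn x hx s hs s' hs'
      refine le_trans (le_of_eq ?_) (mul_le_mul_of_nonneg_left h1 (by positivity))
      simp only [Finset.sum_const, Finset.card_product, Finset.card_range, nsmul_eq_mul]
      push_cast
      field_simp)
    hp
  convert key using 2
  ring

theorem theorem1 (d : ℕ) (S : Finset (Fin d → ℤ)) (hS0 : (0 : Fin d → ℤ) ∉ S)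
    (hSgen : AddSubgroup.closure (S : Set (Fin d → ℤ)) = ⊤)
    (q : ℝ) (hq0 : 0 < q) (hq1 : q < 1)
    {Ω : ℕ → Type*} [∀ n, MeasurableSpace (Ω n)]
    (μ : ∀ n, Measure (Ω n)) [∀ n, IsProbabilityMeasure (μ n)]
    (v : ∀ n, ℕ → Ω n → (Fin d → ZMod (2 * n + 1)))
    (hv : ∀ n, IsUniformIID (μ n) (v n)) :
    AsymptoticallyUnbiased μ
      (fun n x₀ t ω => bgaState (latticeCayleyDigraph S n) q (fun s => v n s ω) x₀ t) := by
  have hG (n : ℕ) := sum_nodeAverage_bgaStep_cayleyDigraph (latticeGenerators S n) q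
  refine ⟨fun n => (hv n).exists_isBiasMatrix hq0.le hq1.le (hG n), fun B hB => ?_⟩
  have htrace (n : ℕ) := (hB n).tendsto_trace (hv n) (hG n)
  -- For `d = 0` there is no coordinate to build characters from, but there is a single node, and
  -- the identity kernel is the constant `1`.
  rcases d.eq_zero_or_pos with rfl | hd
  · have h1 (n : ℕ) : (B n).trace = 0 := by
      have h2 := htrace n
      have h3 : (fun u w : Fin 0 → ZMod (2 * n + 1) => if u = w then (1 : ℝ) else 0) =
          fun _ _ => 1 := by
        ext u w
        simp [Subsingleton.elim u w]
      rw [h3] at h2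
      simp only [meanSecondMoment_const] at h2
      have h4 := tendsto_nhds_unique h2 tendsto_const_nhds
      simpa using h4
    simp only [h1]
    exact tendsto_const_nhds
  · let i : Fin d := ⟨0, hd⟩
    obtain ⟨s, hs, hsi⟩ := exists_apply_ne_zero_of_closure_eq_top hSgen i
    rw [Metric.tendsto_nhds]
    intro ε hε
    have hq2 : 0 < (1 - q) / 2 := by linarith
    obtain ⟨J, hJ⟩ := exists_nat_one_div_lt (mul_pos hq2 hε)
    filter_upwards [eventually_limit_meanSecondMoment_le S i ⟨s, hs, hsi⟩ hq0 hq1 J.succ_pos]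
      with n hn
    have h1 := hn _ (htrace n)
    have h2 : (((J + 1 : ℕ) : ℝ))⁻¹ < (1 - q) / 2 * ε := by
      rw [← one_div]
      exact_mod_cast hJ
    have h3 := lt_of_mul_lt_mul_left (h1.trans_lt h2) hq2.le
    have h4 : 0 ≤ (Fintype.card (Fin d → ZMod (2 * n + 1)) : ℝ)⁻¹ := by positivity
    rw [Real.dist_eq, sub_zero, abs_of_nonneg (hB n).trace_nonneg]
    linarith
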